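/- Let $z=(x,y)$ with $x\in\mathbb R^n$, $y\in\mathbb R^p$ have the nominal Gaussian density $f$ with mean $m_z=(m_x,m_y)$ and symmetric positive definite covariance matrix $K_z=\begin{bmatrix}K_x&K_{xy}\\K_{yx}&K_y\end{bmatrix}$. Let $0\le\tau\le1$ and let $L_z$ be a square matrix with $K_z=L_zL_z^T$. For a Gaussian density $\tilde f$ of $z$ with mean $\tilde m_z$ and positive definite covariance $\tilde K_z$, put $\Delta m=\tilde m_z-m_z$, $S=L_z^{-1}\tilde K_zL_z^{-T}$, and, with $\|v\|_A^2=v^TAv$, $$\mathcal D_\tau(\tilde f\|f)=\begin{cases}\|\Delta m\|^2_{K_z^{-1}}+\operatorname{tr}\left(-\log(\tilde K_zK_z^{-1})+\tilde K_zK_z^{-1}-I\right),&\tau=0,\\[2pt] \|\Delta m\|^2_{\frac1{1-\tau}K_z^{-1}}+\operatorname{tr}\left(-\tfrac1{\tau(1-\tau)}S^\tau+\tfrac1{1-\tau}\tilde K_zK_z^{-1}+\tfrac1\tau I\right),&0<\tau<1,\\[2pt] \delta_\infty(\Delta m)+\operatorname{tr}\left(S\log S-\tilde K_zK_z^{-1}+I\right),&\tau=1,\end{cases}$$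 where $\delta_\infty(0)=0$ and $\delta_\infty(v)=\infty$ for $v\ne0$. Let $P=K_x-K_{xy}K_y^{-1}K_{yx}$ be the nominal a posteriori covariance matrix of $x$ given $y$, let $L_P$ be a square matrix with $P=L_PL_P^T$, and let $\theta>0$ be fixed with $\theta^{-1}>(1-\tau)\|P\|$ (spectral norm). Consider the minimax problem $$\min_{g\in\mathcal G}\ \max_{\tilde f\in\mathcal B_\tau}\ \mathbb E_{\tilde f}\left[\|x-g(y)\|^2\right]-\theta^{-1}\mathcal D_\tau(\tilde f\|f),$$ where $\mathcal B_\tau$ is the set of Gaussian densities $\tilde f$ as above with $\mathcal D_\tau(\tilde f\|f)<\infty$, and $\mathcal G$ is the set of measurable $g:\mathbb R^p\to\mathbb R^n$ with $\mathbb E_{\tilde f}[\|g(y)\|^2]<\infty$ for all $\tilde f\in\mathcal B_\tau$. Then there is a density $\tilde f^\circ\in\mathcal B_\tau$ with mean $m_z$ and positive definite covariance matrix $\tilde K_z^\circ=\begin{bmatrix}\tilde K_x&K_{xy}\\K_{yx}&K_y\end{bmatrix}$, whose a posteriori covariance matrix $V=\tilde K_x-K_{xy}K_y^{-1}K_{yx}$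 is $$V=\begin{cases}L_P\left(I_n-\theta(1-\tau)L_P^TL_P\right)^{\frac1{\tau-1}}L_P^T,&0\le\tau<1,\\ L_P\exp\left(\theta L_P^TL_P\right)L_P^T,&\tau=1,\end{cases}$$ such that the Bayes estimator $g^\circ(y)=K_{xy}K_y^{-1}(y-m_y)+m_x$ and $\tilde f^\circ$ solve the minimax problem: $g^\circ\in\mathcal G$ minimizes over $\mathcal G$ the supremum of the objective over $\tilde f\in\mathcal B_\tau$, and for $g=g^\circ$ the maximum over $\mathcal B_\tau$ is attained at $\tilde f^\circ$. Moreover $g^\circ$ minimizes the objective over $\mathcal G$ when $\tilde f=\tilde f^\circ$, and the solution is unique: if $g\in\mathcal G$ minimizes the worst-case objective and $\tilde f\in\mathcal B_\tau$ maximizes the objective for this $g$, then $\tilde f=\tilde f^\circ$ and $g=g^\circ$ Lebesgue-almost everywhere. -/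

import Mathlib

open Matrix MeasureTheory ProbabilityTheory

noncomputable section

namespace RobustStatic

/-- A nondegenerate Gaussian density on Euclidean space, given by its mean vector and its symmetric
positive definite covariance matrix. -/
@[ext]
structure GaussianDensity (ι : Type*) [Fintype ι] [DecidableEq ι] where
  /-- the mean vector -/
  mean : EuclideanSpace ℝ ι
  /-- the covariance matrix -/
  cov : Matrix ι ι ℝ
  /-- the covariance matrix is symmetric positive definite -/
  posDef : cov.PosDef

/-- The Gaussian probability law with the given mean and covariance. -/
def GaussianDensity.law {ι : Type*} [Fintype ι] [DecidableEq ι] (f : GaussianDensity ι) :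
    Measure (EuclideanSpace ℝ ι) :=
  multivariateGaussian f.mean f.cov

/-- The real matrix function `φ(A)` of a symmetric matrix `A` (`φ` is applied to the eigenvalues
of `A`). -/
def matFun {ι : Type*} [Fintype ι] [DecidableEq ι] (φ : ℝ → ℝ) (A : Matrix ι ι ℝ) : Matrix ι ι ℝ :=
  cfc φ A

/-- The normalized covariance `L⁻¹ K' L⁻ᵀ`. -/
def normalizedCov {ι : Type*} [Fintype ι] [DecidableEq ι] (L K' : Matrix ι ι ℝ) : Matrix ι ι ℝ :=
  L⁻¹ * K' * (L⁻¹)ᵀ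

/-- The squared weighted Euclidean norm `‖v‖²_A = vᵀ A v`. -/
def weightedSq {ι : Type*} [Fintype ι] (A : Matrix ι ι ℝ) (v : EuclideanSpace ℝ ι) : ℝ :=
  v.ofLp ⬝ᵥ (A *ᵥ v.ofLp)

open Classical in
/-- The `τ`-divergence `D_τ(f' ‖ f)` of two Gaussian densities, for `0 ≤ τ ≤ 1`. The square matrix
`L` is a factor of the covariance matrix `K` of `f`, that is `K = L Lᵀ`; the value does not depend
on which one is used.

For `τ = 0` the (principal) logarithm of `K' K⁻¹ = L (L⁻¹ K' L⁻ᵀ) L⁻¹`, a matrix which need not be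
symmetric, is `L log(L⁻¹ K' L⁻ᵀ) L⁻¹`. -/
def tauDiv {ι : Type*} [Fintype ι] [DecidableEq ι] (τ : ℝ) (L : Matrix ι ι ℝ)
    (f' f : GaussianDensity ι) : EReal :=
  if τ = 0 then
    ((weightedSq f.cov⁻¹ (f'.mean - f.mean)
      + trace (-(L * matFun Real.log (normalizedCov L f'.cov) * L⁻¹)
          + f'.cov * f.cov⁻¹ - 1) : ℝ) : EReal)
  else if τ = 1 then
    (if f'.mean - f.mean = 0 then (0 : EReal) else ⊤)
      + ((trace (normalizedCov L f'.cov * matFun Real.log (normalizedCov L f'.cov)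
          - f'.cov * f.cov⁻¹ + 1) : ℝ) : EReal)
  else
    ((weightedSq ((1 / (1 - τ)) • f.cov⁻¹) (f'.mean - f.mean)
      + trace (-((1 / (τ * (1 - τ))) • matFun (fun t => t ^ τ) (normalizedCov L f'.cov))
          + (1 / (1 - τ)) • (f'.cov * f.cov⁻¹) + (1 / τ) • (1 : Matrix ι ι ℝ)) : ℝ) : EReal)

/-- The densities at finite `τ`-divergence from the nominal density `f`. -/
def uncertaintySet {ι : Type*} [Fintype ι] [DecidableEq ι] (τ : ℝ) (L : Matrix ι ι ℝ)
    (f : GaussianDensity ι) : Set (GaussianDensity ι) :=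
  {f' | tauDiv τ L f' f < ⊤}

/-- The block `x` of `z = (x, y)`. -/
def xPart {n p : ℕ} (z : EuclideanSpace ℝ (Fin n ⊕ Fin p)) : EuclideanSpace ℝ (Fin n) :=
  WithLp.toLp 2 fun i => z (Sum.inl i)

/-- The block `y` of `z = (x, y)`. -/
def yPart {n p : ℕ} (z : EuclideanSpace ℝ (Fin n ⊕ Fin p)) : EuclideanSpace ℝ (Fin p) :=
  WithLp.toLp 2 fun j => z (Sum.inr j)

/-- The estimators of `x` based on `y`: the measurable maps `g` such that `E_f' ‖g(y)‖²` is finite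
for every `f'` in the class `B`. -/
def estimators {n p : ℕ} (B : Set (GaussianDensity (Fin n ⊕ Fin p))) :
    Set (EuclideanSpace ℝ (Fin p) → EuclideanSpace ℝ (Fin n)) :=
  {g | Measurable g ∧ ∀ f' ∈ B, Integrable (fun z => ‖g (yPart z)‖ ^ 2) f'.law}

/-- The mean square error `E_f' ‖x - g(y)‖²`. -/
def mse {n p : ℕ} (f' : GaussianDensity (Fin n ⊕ Fin p))
    (g : EuclideanSpace ℝ (Fin p) → EuclideanSpace ℝ (Fin n)) : ℝ :=
  ∫ z, ‖xPart z - g (yPart z)‖ ^ 2 ∂f'.law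

/-- The penalized objective `E_f' ‖x - g(y)‖² - θ⁻¹ D_τ(f' ‖ f)`. -/
def penalized {n p : ℕ} (τ θ : ℝ) (L : Matrix (Fin n ⊕ Fin p) (Fin n ⊕ Fin p) ℝ)
    (f f' : GaussianDensity (Fin n ⊕ Fin p))
    (g : EuclideanSpace ℝ (Fin p) → EuclideanSpace ℝ (Fin n)) : EReal :=
  (mse f' g : EReal) - ((θ⁻¹ : ℝ) : EReal) * tauDiv τ L f' f

/-- `(g, f')` solves `min_{g ∈ G} max_{f' ∈ B} J f' g`: the strategy `g` minimizes the worst case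
`sup_{f' ∈ B} J f' g` over `G`, and for this `g` the maximum over `B` is attained at `f'`. -/
structure IsMinimaxSolution {F E : Type*} (J : F → E → EReal) (G : Set E) (B : Set F)
    (g : E) (f' : F) : Prop where
  mem_G : g ∈ G
  mem_B : f' ∈ B
  minimizes : ∀ g' ∈ G, (⨆ f'' ∈ B, J f'' g) ≤ ⨆ f'' ∈ B, J f'' g'
  maximizes : ∀ f'' ∈ B, J f'' g ≤ J f' g

/-- The Bayes estimator `y ↦ G (y - m_y) + m_x`, where `G = K_xy K_y⁻¹`. -/
def bayes {n p : ℕ} (m : EuclideanSpace ℝ (Fin n ⊕ Fin p)) (Kxy : Matrix (Fin n) (Fin p) ℝ)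
    (Ky : Matrix (Fin p) (Fin p) ℝ) (y : EuclideanSpace ℝ (Fin p)) : EuclideanSpace ℝ (Fin n) :=
  WithLp.toLp 2 ((Kxy * Ky⁻¹) *ᵥ (y - yPart m).ofLp) + xPart m

/-- The a posteriori covariance matrix `K_x - K_xy K_y⁻¹ K_yx` of `x` given `y`. -/
def posteriorCov {n p : ℕ} (Kx : Matrix (Fin n) (Fin n) ℝ) (Kxy : Matrix (Fin n) (Fin p) ℝ)
    (Kyx : Matrix (Fin p) (Fin n) ℝ) (Ky : Matrix (Fin p) (Fin p) ℝ) : Matrix (Fin n) (Fin n) ℝ :=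
  Kx - Kxy * Ky⁻¹ * Kyx

open Classical in
/-- `L (I - θ(1-τ) Lᵀ L)^(1/(τ-1)) Lᵀ` for `0 ≤ τ < 1`, and `L exp(θ Lᵀ L) Lᵀ` for `τ = 1`. -/
def perturbedCov {n : ℕ} (τ θ : ℝ) (L : Matrix (Fin n) (Fin n) ℝ) : Matrix (Fin n) (Fin n) ℝ :=
  if τ = 1 then
    L * matFun Real.exp (θ • (Lᵀ * L)) * Lᵀ
  else
    L * matFun (fun t => t ^ (1 / (τ - 1))) (1 - (θ * (1 - τ)) • (Lᵀ * L)) * Lᵀ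

/-- The spectral (Euclidean operator) norm of a real square matrix. -/
def specNorm {n : ℕ} (A : Matrix (Fin n) (Fin n) ℝ) : ℝ :=
  ‖Matrix.toEuclideanCLM (𝕜 := ℝ) A‖

end RobustStatic

end

/-! The pair $(g^\circ,\tilde f^\circ)$ is a saddle point. Put $E=[I,-K_{xy}K_y^{-1}]$, so that
$E(z-m_z)$ is the error of $g^\circ$, $N=EL_z$, $u=L_z^{-1}\Delta m$ and $S=L_z^{-1}\tilde
K_zL_z^{-T}$. For $g=g^\circ$ the objective splits into a mean part
$\|Nu\|^2-\frac{\theta^{-1}}{1-\tau}\|u\|^2$ (for $\tau=1$ finite divergence forces $u=0$) and a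
covariance part $\theta^{-1}(\operatorname{tr}(SB)-\operatorname{tr}\,d(S))$, with $B=\theta N^TN$
and $d$ = `divFun τ`.

Since $NN^T=P$, the hypothesis on $\theta$ makes the mean part negative unless $u=0$. The scalar
function $sb-d(s)$ has a strict maximum at $s=\psi(b)$, $\psi$ = `tiltFun τ` (`divFun_gap_pos`). The
Klein-type inequality `trace_fenchel` lifts this to matrices: $S=\psi(B)$ is the unique maximizer.

Because $\psi(0)=1$, $\psi(\theta N^TN)=I+N^TQN$ with $Q$ a polynomial in $NN^T=P$
(`exists_cfc_transpose_mul_self`). As $L_zN^T$ is $P$ stacked on $0$, conjugating by $L_z$ changes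
only the $x$ block, by $PQP$. The same $Q$ serves $L_P$, since $L_PL_P^T=P$, and this gives the
formula for $V$ (`exists_worst_cov`).

So $\tilde f^\circ$ keeps $K_{xy}$ and $K_y$, and $g^\circ$ is also its Bayes estimator.
Orthogonality of the error (`mse_eq_add`) shows that any other minimax $g$ agrees with $g^\circ$
almost everywhere for the law of $y$, hence for Lebesgue measure. Strictness of the maximum then
identifies the density. -/

noncomputable section

namespace RobustStatic

/-! ### Nondegenerate Gaussian laws are equivalent to Lebesgue measure -/

section AbsolutelyContinuous

open scoped MatrixOrder

lemma pi_fin_absolutelyContinuous : ∀ (n : ℕ) {μ ν : Measure ℝ} [SigmaFinite μ] [SigmaFinite ν],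
    μ ≪ ν → Measure.pi (fun _ : Fin n => μ) ≪ Measure.pi (fun _ : Fin n => ν)
  | 0, μ, ν, _, _, _ => by
    rw [Measure.pi_of_empty (fun _ : Fin 0 => μ), Measure.pi_of_empty (fun _ : Fin 0 => ν)]
  | n + 1, μ, ν, _, _, h => by
    have hμ := (measurePreserving_piFinSuccAbove (fun _ : Fin (n + 1) => μ) 0).symm
    have hν := (measurePreserving_piFinSuccAbove (fun _ : Fin (n + 1) => ν) 0).symm
    rw [← hμ.map_eq, ← hν.map_eq]
    exact (h.prod (pi_fin_absolutelyContinuous n h)).map hν.measurable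

variable {ι : Type*} [Fintype ι]

/-- The map is the one that defines `stdGaussian` from a product of real Gaussians, so absolute
continuity can be checked on the products and transported. -/
lemma map_orthonormalBasis_pi_volume :
    (Measure.pi (fun _ : Fin (Module.finrank ℝ (EuclideanSpace ℝ ι)) => (volume : Measure ℝ))).map
      (fun x => ∑ i, x i • stdOrthonormalBasis ℝ (EuclideanSpace ℝ ι) i) = volume := by
  have h := (stdOrthonormalBasis ℝ (EuclideanSpace ℝ ι)).measurePreserving_repr_symm.comp
    (PiLp.volume_preserving_toLp (Fin (Module.finrank ℝ (EuclideanSpace ℝ ι))))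
  rw [← h.map_eq, ← volume_pi]
  congr 1
  ext1 x
  simp [OrthonormalBasis.sum_repr_symm]

lemma stdGaussian_absolutelyContinuous :
    stdGaussian (EuclideanSpace ℝ ι) ≪ volume := by
  rw [← map_orthonormalBasis_pi_volume, stdGaussian]
  exact (pi_fin_absolutelyContinuous _ (gaussianReal_absolutelyContinuous 0 one_ne_zero)).map
    (by fun_prop)

lemma absolutelyContinuous_stdGaussian :
    volume ≪ stdGaussian (EuclideanSpace ℝ ι) := by
  rw [← map_orthonormalBasis_pi_volume, stdGaussian]
  exact (pi_fin_absolutelyContinuous _ (gaussianReal_absolutelyContinuous' 0 one_ne_zero)).map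
    (by fun_prop)

variable [DecidableEq ι] {S : Matrix ι ι ℝ}

lemma isUnit_sqrt (hS : S.PosDef) : IsUnit (CFC.sqrt S) := by
  rw [Matrix.isUnit_iff_isUnit_det]
  have h : (CFC.sqrt S * CFC.sqrt S).det ≠ 0 := by
    rw [CFC.sqrt_mul_sqrt_self S (Matrix.nonneg_iff_posSemidef.2 hS.posSemidef)]
    exact hS.det_pos.ne'
  rw [det_mul] at h
  exact (left_ne_zero_of_mul h).isUnit

/-- The map carries the standard Gaussian to the one with parameters `μ`, `S`. It is invertible, so
it scales Lebesgue measure; `c ≠ 0` is what absolute continuity of `volume` requires. -/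
lemma map_affine_volume (μ : EuclideanSpace ℝ ι) (hS : S.PosDef) :
    ∃ c : ENNReal, c ≠ 0 ∧ (volume : Measure (EuclideanSpace ℝ ι)).map
      (fun x => μ + toEuclideanCLM (𝕜 := ℝ) (CFC.sqrt S) x) = c • volume := by
  set T : EuclideanSpace ℝ ι →ₗ[ℝ] EuclideanSpace ℝ ι :=
    (toEuclideanCLM (𝕜 := ℝ) (CFC.sqrt S)).toLinearMap
  have hT : LinearMap.det T ≠ 0 := by
    obtain ⟨u, hu⟩ := (isUnit_sqrt hS).map (toEuclideanCLM (𝕜 := ℝ))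
    have h : T ∘ₗ (u⁻¹).val.toLinearMap = LinearMap.id := by
      have := congrArg ContinuousLinearMap.toLinearMap u.mul_inv
      rwa [hu] at this
    have h' := congrArg LinearMap.det h
    rw [LinearMap.det_comp, LinearMap.det_id] at h'
    exact left_ne_zero_of_mul (h' ▸ one_ne_zero)
  refine ⟨ENNReal.ofReal |(LinearMap.det T)⁻¹|, by simpa using hT, ?_⟩
  have h : (fun x => μ + toEuclideanCLM (𝕜 := ℝ) (CFC.sqrt S) x) = (fun x => μ + x) ∘ T := rfl
  rw [h, ← Measure.map_map (measurable_const_add μ) (by fun_prop),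
    Measure.map_linearMap_addHaar_eq_smul_addHaar _ hT, Measure.map_smul, map_add_left_eq_self]

lemma multivariateGaussian_absolutelyContinuous (μ : EuclideanSpace ℝ ι) (hS : S.PosDef) :
    multivariateGaussian μ S ≪ volume := by
  obtain ⟨c, -, h⟩ := map_affine_volume μ hS
  refine (stdGaussian_absolutelyContinuous.map (by fun_prop)).trans ?_
  rw [h]
  exact Measure.smul_absolutelyContinuous

lemma absolutelyContinuous_multivariateGaussian (μ : EuclideanSpace ℝ ι) (hS : S.PosDef) :
    volume ≪ multivariateGaussian μ S := by
  obtain ⟨c, hc, h⟩ := map_affine_volume μ hS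
  refine Measure.AbsolutelyContinuous.trans ?_
    (absolutelyContinuous_stdGaussian.map (by fun_prop))
  rw [h]
  exact Measure.absolutelyContinuous_smul hc

end AbsolutelyContinuous

/-! ### First and second moments of Gaussian laws -/

section Moments

instance {ι : Type*} [Fintype ι] [DecidableEq ι] (f : GaussianDensity ι) : IsGaussian f.law := by
  unfold GaussianDensity.law; infer_instance

variable {ι : Type*} [Fintype ι] [DecidableEq ι] (f : GaussianDensity ι)

lemma memLp_dotProduct (a : ι → ℝ) (m : EuclideanSpace ℝ ι) :
    MemLp (fun z : EuclideanSpace ℝ ι => a ⬝ᵥ (z - m).ofLp) 2 f.law := by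
  have h : (fun z : EuclideanSpace ℝ ι => a ⬝ᵥ (z - m).ofLp)
      = fun z => inner ℝ (WithLp.toLp 2 a) (z - m) := by
    ext z; simp [PiLp.inner_apply, dotProduct, mul_comm]
  rw [h]
  have h2 : MemLp (fun z : EuclideanSpace ℝ ι => z - m) 2 f.law :=
    IsGaussian.memLp_two_id.sub (memLp_const m)
  exact h2.const_inner _

lemma integral_dotProduct (a : ι → ℝ) (m : EuclideanSpace ℝ ι) :
    ∫ z, a ⬝ᵥ (z - m).ofLp ∂f.law = a ⬝ᵥ (f.mean - m).ofLp := by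
  have h (z : EuclideanSpace ℝ ι) : a ⬝ᵥ (z - m).ofLp = inner ℝ (WithLp.toLp 2 a) (z - m) := by
    simp [PiLp.inner_apply, dotProduct, mul_comm]
  simp_rw [h]
  have hi : Integrable (fun z : EuclideanSpace ℝ ι => z) f.law := IsGaussian.integrable_id
  have hm : Integrable (fun z : EuclideanSpace ℝ ι => z - m) f.law := hi.sub (integrable_const m)
  rw [integral_inner hm, integral_sub hi (integrable_const m)]
  simp [GaussianDensity.law]

lemma covariance_dotProduct (a b : ι → ℝ) (m : EuclideanSpace ℝ ι) :
    cov[fun z : EuclideanSpace ℝ ι => a ⬝ᵥ (z - m).ofLp,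
      fun z : EuclideanSpace ℝ ι => b ⬝ᵥ (z - m).ofLp; f.law] = a ⬝ᵥ f.cov *ᵥ b := by
  have h (a : ι → ℝ) (z : EuclideanSpace ℝ ι) :
      a ⬝ᵥ (z - m).ofLp = inner ℝ (WithLp.toLp 2 a) z - a ⬝ᵥ m.ofLp := by
    simp [PiLp.inner_apply, dotProduct, mul_comm, mul_sub]
  have hi (a : ι → ℝ) : MemLp (fun z : EuclideanSpace ℝ ι => inner ℝ (WithLp.toLp 2 a) z) 2 f.law :=
    IsGaussian.memLp_two_id.const_inner _
  simp_rw [h]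
  rw [covariance_sub_const_left ((hi a).integrable one_le_two), covariance_sub_const_right,
    ← covarianceBilin_apply_eq_cov IsGaussian.memLp_two_id, GaussianDensity.law,
    covarianceBilin_multivariateGaussian f.posDef.posSemidef]
  · exact (hi b).integrable one_le_two

lemma integral_sq_dotProduct (a : ι → ℝ) (m : EuclideanSpace ℝ ι) :
    ∫ z, (a ⬝ᵥ (z - m).ofLp) ^ 2 ∂f.law = (a ⬝ᵥ (f.mean - m).ofLp) ^ 2 + a ⬝ᵥ f.cov *ᵥ a := by
  have h := covariance_eq_sub (memLp_dotProduct f a m) (memLp_dotProduct f a m)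
  rw [covariance_dotProduct, integral_dotProduct] at h
  simp only [Pi.mul_apply] at h
  simp_rw [sq]
  linarith

/-- Bias plus variance, row by row. The centre `m` is free because the competing densities may have
a mean other than the nominal one. -/
lemma integral_norm_sq_mulVec {κ : Type*} [Fintype κ] (A : Matrix κ ι ℝ) (m : EuclideanSpace ℝ ι) :
    ∫ z, ‖WithLp.toLp 2 (A *ᵥ (z - m).ofLp)‖ ^ 2 ∂f.law
      = ‖WithLp.toLp 2 (A *ᵥ (f.mean - m).ofLp)‖ ^ 2 + trace (A * f.cov * Aᵀ) := by
  simp_rw [EuclideanSpace.real_norm_sq_eq]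
  simp only [mulVec]
  rw [integral_finsetSum _ fun i _ => (memLp_dotProduct f (A i) m).integrable_sq]
  simp_rw [integral_sq_dotProduct, Finset.sum_add_distrib]
  congr 1
  refine Finset.sum_congr rfl fun i _ => ?_
  rw [diag_apply, Matrix.mul_assoc, mul_apply]
  simp [dotProduct, mulVec, mul_apply]

end Moments

/-! ### The law of y and orthogonality of the estimation error -/

section Bayes

variable {n p : ℕ}

/-- The projection `z = (x, y) ↦ y` as a continuous linear map. -/
def yPartCLM (n p : ℕ) :
    EuclideanSpace ℝ (Fin n ⊕ Fin p) →L[ℝ] EuclideanSpace ℝ (Fin p) :=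
  LinearMap.toContinuousLinearMap
    { toFun := yPart, map_add' := fun _ _ => rfl, map_smul' := fun _ _ => rfl }

@[simp] lemma yPartCLM_apply (z : EuclideanSpace ℝ (Fin n ⊕ Fin p)) :
    yPartCLM n p z = yPart z := rfl

lemma measurable_yPart : Measurable (yPart (n := n) (p := p)) := (yPartCLM n p).continuous.measurable

lemma posDef_toBlocks₂₂ (f : GaussianDensity (Fin n ⊕ Fin p)) : f.cov.toBlocks₂₂.PosDef :=
  f.posDef.submatrix Sum.inr_injective

/-- A linear image of a Gaussian law is Gaussian, hence determined by its mean and covariance, which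
are compared on a basis. -/
lemma map_yPart_law (f : GaussianDensity (Fin n ⊕ Fin p)) :
    f.law.map yPart = multivariateGaussian (yPart f.mean) f.cov.toBlocks₂₂ := by
  have : IsGaussian (f.law.map yPart) := inferInstanceAs (IsGaussian (f.law.map (yPartCLM n p)))
  apply IsGaussian.ext
  · change (f.law.map (yPartCLM n p))[id] = _
    simp only [id_eq, integral_id_multivariateGaussian]
    rw [ContinuousLinearMap.integral_id_map IsGaussian.integrable_id, GaussianDensity.law,
      integral_id_multivariateGaussian, yPartCLM_apply]
  rw [← ContinuousLinearMap.toBilinForm_inj]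
  refine LinearMap.BilinForm.ext_basis (EuclideanSpace.basisFun (Fin p) ℝ).toBasis fun i j => ?_
  rw [ContinuousLinearMap.toBilinForm_apply, ContinuousLinearMap.toBilinForm_apply,
    covarianceBilin_multivariateGaussian (posDef_toBlocks₂₂ f).posSemidef,
    covarianceBilin_apply_eq_cov IsGaussian.memLp_two_id, covariance_map]
  · have h (i : Fin p) : (fun u => inner ℝ ((EuclideanSpace.basisFun (Fin p) ℝ).toBasis i) u) ∘ yPart
        = fun z : EuclideanSpace ℝ (Fin n ⊕ Fin p) =>
          Pi.single (Sum.inr i) 1 ⬝ᵥ (z - 0).ofLp := by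
      ext z; simp [PiLp.inner_apply, yPart]
    rw [h, h, covariance_dotProduct]
    simp [toBlocks₂₂]
  · exact Measurable.aestronglyMeasurable (by fun_prop)
  · exact Measurable.aestronglyMeasurable (by fun_prop)
  · exact measurable_yPart.aemeasurable

lemma map_yPart_absolutelyContinuous (f : GaussianDensity (Fin n ⊕ Fin p)) :
    f.law.map yPart ≪ volume := by
  rw [map_yPart_law]
  exact multivariateGaussian_absolutelyContinuous _ (posDef_toBlocks₂₂ f)

lemma absolutelyContinuous_map_yPart (f : GaussianDensity (Fin n ⊕ Fin p)) :
    volume ≪ f.law.map yPart := by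
  rw [map_yPart_law]
  exact absolutelyContinuous_multivariateGaussian _ (posDef_toBlocks₂₂ f)

/-- The matrix `[I, -K_xy K_y⁻¹]` of the estimation error `x - g°(y)`. -/
def errorMatrix (Kxy : Matrix (Fin n) (Fin p) ℝ) (Ky : Matrix (Fin p) (Fin p) ℝ) :
    Matrix (Fin n) (Fin n ⊕ Fin p) ℝ :=
  fromCols 1 (-(Kxy * Ky⁻¹))

lemma xPart_sub_bayes (m : EuclideanSpace ℝ (Fin n ⊕ Fin p)) (Kxy : Matrix (Fin n) (Fin p) ℝ)
    (Ky : Matrix (Fin p) (Fin p) ℝ) (z : EuclideanSpace ℝ (Fin n ⊕ Fin p)) :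
    xPart z - bayes m Kxy Ky (yPart z)
      = WithLp.toLp 2 (errorMatrix Kxy Ky *ᵥ (z - m).ofLp) := by
  have h : (z - m).ofLp = Sum.elim (xPart (z - m)).ofLp (yPart (z - m)).ofLp := by
    ext i; cases i <;> rfl
  rw [h, errorMatrix, fromCols_mulVec_sumElim]
  have h2 : yPart (z - m) = yPart z - yPart m := rfl
  ext i
  simp [bayes, h2, neg_mulVec, xPart]
  ring

lemma measurable_bayes (m : EuclideanSpace ℝ (Fin n ⊕ Fin p)) (Kxy : Matrix (Fin n) (Fin p) ℝ)
    (Ky : Matrix (Fin p) (Fin p) ℝ) : Measurable (bayes m Kxy Ky) := by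
  have : Continuous (bayes m Kxy Ky) := by
    unfold bayes
    refine Continuous.add ?_ continuous_const
    refine (PiLp.continuous_toLp 2 _).comp ?_
    exact Continuous.matrix_mulVec continuous_const (by fun_prop)
  exact this.measurable

lemma memLp_bayes (f : GaussianDensity (Fin n ⊕ Fin p)) (m : EuclideanSpace ℝ (Fin n ⊕ Fin p))
    (Kxy : Matrix (Fin n) (Fin p) ℝ) (Ky : Matrix (Fin p) (Fin p) ℝ) :
    MemLp (fun z => bayes m Kxy Ky (yPart z)) 2 f.law := by
  have h : MemLp (fun z => yPart z - yPart m) 2 f.law :=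
    ((yPartCLM n p).comp_memLp' IsGaussian.memLp_two_id).sub (memLp_const _)
  have h2 := (LinearMap.toContinuousLinearMap (toLpLin 2 2 (Kxy * Ky⁻¹))).comp_memLp' h
  exact h2.add (memLp_const (xPart m))

/-- The hypothesis `hA` says that the error `A (z - m)` is uncorrelated with y; for jointly Gaussian
vectors this is independence. -/
lemma indepFun_error (f : GaussianDensity (Fin n ⊕ Fin p)) (A : Matrix (Fin n) (Fin n ⊕ Fin p) ℝ)
    (hA : (A * f.cov).toCols₂ = 0) (m : EuclideanSpace ℝ (Fin n ⊕ Fin p)) :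
    IndepFun (fun z : EuclideanSpace ℝ (Fin n ⊕ Fin p) => fun i => A i ⬝ᵥ (z - m).ofLp)
      (fun z : EuclideanSpace ℝ (Fin n ⊕ Fin p) => fun j =>
        (Pi.single (Sum.inr j) 1 : Fin n ⊕ Fin p → ℝ) ⬝ᵥ (z - m).ofLp) f.law := by
  apply HasGaussianLaw.indepFun_of_covariance_eval
  · have h : HasGaussianLaw (fun z : EuclideanSpace ℝ (Fin n ⊕ Fin p) => z - m) f.law :=
      ⟨inferInstance⟩
    exact h.map_fun (LinearMap.toContinuousLinearMap
      { toFun := fun u : EuclideanSpace ℝ (Fin n ⊕ Fin p) => ((fun i : Fin n => A i ⬝ᵥ u.ofLp,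
          fun j : Fin p => (Pi.single (Sum.inr j) 1 : Fin n ⊕ Fin p → ℝ) ⬝ᵥ u.ofLp) :
          (Fin n → ℝ) × (Fin p → ℝ))
        map_add' := fun u v => by ext <;> simp [dotProduct_add]
        map_smul' := fun c u => by ext <;> simp [dotProduct_smul] })
  · intro i j
    rw [covariance_dotProduct]
    have := congrFun (congrFun hA i) j
    simp only [toCols₂, of_apply, mul_apply, Matrix.zero_apply] at this
    simpa [dotProduct] using this

/-- Pythagoras: each cross term is the mean of a product of independent variables, one of which is
centred. -/
lemma integral_norm_sq_error_add (f : GaussianDensity (Fin n ⊕ Fin p))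
    (A : Matrix (Fin n) (Fin n ⊕ Fin p) ℝ) (hA : (A * f.cov).toCols₂ = 0)
    (h : EuclideanSpace ℝ (Fin p) → EuclideanSpace ℝ (Fin n)) (hm : Measurable h)
    (hi : MemLp (fun z => h (yPart z)) 2 f.law) :
    ∫ z, ‖WithLp.toLp 2 (A *ᵥ (z - f.mean).ofLp) + h (yPart z)‖ ^ 2 ∂f.law
      = ∫ z, ‖WithLp.toLp 2 (A *ᵥ (z - f.mean).ofLp)‖ ^ 2 ∂f.law
        + ∫ z, ‖h (yPart z)‖ ^ 2 ∂f.law := by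
  have hX (i : Fin n) := memLp_dotProduct f (A i) f.mean
  have hY (i : Fin n) : MemLp (fun z => h (yPart z) i) 2 f.law :=
    (EuclideanSpace.proj (𝕜 := ℝ) i).comp_memLp' hi
  have hind (i : Fin n) : ∫ z, (A i ⬝ᵥ (z - f.mean).ofLp) * h (yPart z) i ∂f.law = 0 := by
    have h1 : IndepFun (fun z : EuclideanSpace ℝ (Fin n ⊕ Fin p) => A i ⬝ᵥ (z - f.mean).ofLp)
        (fun z => h (yPart z) i) f.law := by
      -- Writing y through its centred coordinates exhibits `h (yPart z) i` as a measurable function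
      -- of the second vector in `indepFun_error`.
      have hz (z : EuclideanSpace ℝ (Fin n ⊕ Fin p)) : yPart z = (WithLp.toLp 2 fun j =>
          (Pi.single (Sum.inr j) 1 : Fin n ⊕ Fin p → ℝ) ⬝ᵥ (z - f.mean).ofLp) + yPart f.mean := by
        ext j; simp [yPart]
      have he : (fun z => h (yPart z) i) = (fun v : Fin p → ℝ =>
          h (WithLp.toLp 2 v + yPart f.mean) i) ∘ fun z : EuclideanSpace ℝ (Fin n ⊕ Fin p) =>
          fun j => (Pi.single (Sum.inr j) 1 : Fin n ⊕ Fin p → ℝ) ⬝ᵥ (z - f.mean).ofLp := by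
        funext z
        rw [hz z, Function.comp_apply]
      rw [he]
      exact (indepFun_error f A hA f.mean).comp (measurable_pi_apply i) (by fun_prop)
    rw [h1.integral_fun_mul_eq_mul_integral (hX i).aestronglyMeasurable (hY i).aestronglyMeasurable,
      integral_dotProduct]
    simp
  have h1 (z : EuclideanSpace ℝ (Fin n ⊕ Fin p)) :
      ‖WithLp.toLp 2 (A *ᵥ (z - f.mean).ofLp)‖ ^ 2 = ∑ i, (A i ⬝ᵥ (z - f.mean).ofLp) ^ 2 := by
    rw [EuclideanSpace.real_norm_sq_eq]; rfl
  have h2 (z : EuclideanSpace ℝ (Fin n ⊕ Fin p)) :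
      ‖WithLp.toLp 2 (A *ᵥ (z - f.mean).ofLp) + h (yPart z)‖ ^ 2
        = ∑ i, ((A i ⬝ᵥ (z - f.mean).ofLp) ^ 2 + (h (yPart z) i) ^ 2
          + 2 * ((A i ⬝ᵥ (z - f.mean).ofLp) * h (yPart z) i)) := by
    rw [EuclideanSpace.real_norm_sq_eq]
    refine Finset.sum_congr rfl fun i _ => ?_
    simp only [PiLp.add_apply, mulVec]
    ring
  have hs (i : Fin n) : Integrable (fun z : EuclideanSpace ℝ (Fin n ⊕ Fin p) =>
      (A i ⬝ᵥ (z - f.mean).ofLp) ^ 2 + (h (yPart z) i) ^ 2) f.law :=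
    (hX i).integrable_sq.add (hY i).integrable_sq
  have hp (i : Fin n) : Integrable (fun z : EuclideanSpace ℝ (Fin n ⊕ Fin p) =>
      2 * ((A i ⬝ᵥ (z - f.mean).ofLp) * h (yPart z) i)) f.law :=
    ((hX i).integrable_mul (hY i)).const_mul 2
  simp_rw [h1, h2, EuclideanSpace.real_norm_sq_eq]
  rw [integral_finsetSum _ fun i _ => (hY i).integrable_sq,
    integral_finsetSum _ fun i _ => (hX i).integrable_sq,
    integral_finsetSum Finset.univ fun i _ => (hs i).fun_add (hp i), ← Finset.sum_add_distrib]
  refine Finset.sum_congr rfl fun i _ => ?_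
  rw [← integral_add (hX i).integrable_sq (hY i).integrable_sq, integral_add (hs i) (hp i),
    integral_const_mul, hind, mul_zero, add_zero]

end Bayes

/-! ### Trace inequalities through the eigenvalues -/

section SpectralTraces

variable {ι : Type*} [Fintype ι] [DecidableEq ι]

lemma exists_diagonalization {A : Matrix ι ι ℝ} (hA : A.IsHermitian) :
    ∃ (U : Matrix ι ι ℝ) (a : ι → ℝ), U * Uᵀ = 1 ∧ Uᵀ * U = 1 ∧ (∀ i, a i ∈ spectrum ℝ A) ∧
      ∀ f : ℝ → ℝ, cfc f A = U * diagonal (fun i => f (a i)) * Uᵀ := by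
  refine ⟨hA.eigenvectorUnitary, hA.eigenvalues, ?_, ?_, hA.eigenvalues_mem_spectrum_real, ?_⟩
  · simpa [star_eq_conjTranspose, conjTranspose_eq_transpose_of_trivial]
      using Unitary.coe_mul_star_self hA.eigenvectorUnitary
  · simpa [star_eq_conjTranspose, conjTranspose_eq_transpose_of_trivial]
      using Unitary.coe_star_mul_self hA.eigenvectorUnitary
  · intro f
    rw [hA.cfc_eq, IsHermitian.cfc, Unitary.conjStarAlgAut_apply, star_eq_conjTranspose,
      conjTranspose_eq_transpose_of_trivial]
    rfl

/-- Finiteness of the spectrum removes every regularity condition from the functional calculus. -/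
lemma continuousOn_spectrum (A : Matrix ι ι ℝ) (f : ℝ → ℝ) : ContinuousOn f (spectrum ℝ A) :=
  A.finite_real_spectrum.continuousOn f

lemma cfc_comp_of_isHermitian {A : Matrix ι ι ℝ} (hA : A.IsHermitian) (g f : ℝ → ℝ) :
    cfc g (cfc f A) = cfc (fun t => g (f t)) A :=
  (cfc_comp' g f A ((A.finite_real_spectrum.image f).continuousOn g)
    (continuousOn_spectrum A f) hA).symm

lemma sum_sq_row {W : Matrix ι ι ℝ} (hW : W * Wᵀ = 1) (i : ι) : ∑ j, W i j ^ 2 = 1 := by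
  have := congrFun (congrFun hW i) i
  simpa [mul_apply, sq] using this

/-- A trace inequality of Klein type: a pointwise Fenchel inequality on the spectra passes to
traces, and so does its case of equality. -/
lemma trace_fenchel {A B : Matrix ι ι ℝ} (hA : A.IsHermitian) (hB : B.IsHermitian)
    (f k ψ : ℝ → ℝ) (h : ∀ a ∈ spectrum ℝ A, ∀ b ∈ spectrum ℝ B, a * b - f a ≤ k b)
    (h' : ∀ a ∈ spectrum ℝ A, ∀ b ∈ spectrum ℝ B, a * b - f a = k b → a = ψ b) :
    trace (A * B) - trace (cfc f A) ≤ trace (cfc k B) ∧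
      (trace (A * B) - trace (cfc f A) = trace (cfc k B) → A = cfc ψ B) := by
  obtain ⟨U, a, hU, hU', ha, hcA⟩ := exists_diagonalization hA
  obtain ⟨V, b, hV, hV', hb, hcB⟩ := exists_diagonalization hB
  have eA : A = U * diagonal a * Uᵀ := by
    exact (cfc_id ℝ A hA.isSelfAdjoint).symm.trans (hcA id)
  have eB : B = V * diagonal b * Vᵀ := by
    exact (cfc_id ℝ B hB.isSelfAdjoint).symm.trans (hcB id)
  -- `W` is orthogonal, so the squares of its entries form a doubly stochastic matrix. With these
  -- weights all three traces become double sums over pairs of eigenvalues.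
  set W := Uᵀ * V with hWdef
  have hWt : Wᵀ = Vᵀ * U := by rw [hWdef, transpose_mul, transpose_transpose]
  have hW : W * Wᵀ = 1 := by
    rw [hWt, hWdef, Matrix.mul_assoc, ← Matrix.mul_assoc V, hV, Matrix.one_mul, hU']
  have hW' : Wᵀ * Wᵀᵀ = 1 := by
    rw [transpose_transpose, hWt, hWdef, Matrix.mul_assoc, ← Matrix.mul_assoc U, hU,
      Matrix.one_mul, hV']
  have tA : trace (cfc f A) = ∑ i, ∑ j, W i j ^ 2 * f (a i) := by
    rw [hcA, Matrix.mul_assoc, trace_mul_comm, Matrix.mul_assoc, hU', Matrix.mul_one, trace_diagonal]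
    exact Finset.sum_congr rfl fun i _ => by rw [← Finset.sum_mul, sum_sq_row hW, one_mul]
  have tB : trace (cfc k B) = ∑ i, ∑ j, W i j ^ 2 * k (b j) := by
    rw [hcB, Matrix.mul_assoc, trace_mul_comm, Matrix.mul_assoc, hV', Matrix.mul_one, trace_diagonal,
      Finset.sum_comm]
    refine Finset.sum_congr rfl fun j _ => ?_
    have := sum_sq_row hW' j
    simp only [transpose_apply] at this
    rw [← Finset.sum_mul, this, one_mul]
  have tAB : trace (A * B) = ∑ i, ∑ j, W i j ^ 2 * (a i * b j) := by
    have : trace (A * B) = trace (diagonal a * W * (diagonal b * Wᵀ)) := by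
      rw [eA, eB, hWt, hWdef]
      simp only [Matrix.mul_assoc]
      rw [trace_mul_comm]
      simp only [Matrix.mul_assoc]
    rw [this, trace]
    refine Finset.sum_congr rfl fun i _ => ?_
    rw [diag_apply, mul_apply]
    refine Finset.sum_congr rfl fun j _ => ?_
    rw [diagonal_mul, diagonal_mul, transpose_apply]
    ring
  have key : trace (cfc k B) - (trace (A * B) - trace (cfc f A))
      = ∑ i, ∑ j, W i j ^ 2 * (k (b j) - (a i * b j - f (a i))) := by
    rw [tA, tB, tAB]
    simp only [← Finset.sum_sub_distrib]
    refine Finset.sum_congr rfl fun i _ => Finset.sum_congr rfl fun j _ => ?_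
    ring
  have hnn (i j : ι) : 0 ≤ W i j ^ 2 * (k (b j) - (a i * b j - f (a i))) :=
    mul_nonneg (sq_nonneg _) (sub_nonneg.2 (h _ (ha i) _ (hb j)))
  refine ⟨?_, fun heq => ?_⟩
  · rw [← sub_nonneg, key]
    exact Finset.sum_nonneg fun i _ => Finset.sum_nonneg fun j _ => hnn i j
  · rw [heq, sub_self, eq_comm, Finset.sum_eq_zero_iff_of_nonneg
      fun i _ => Finset.sum_nonneg fun j _ => hnn i j] at key
    -- In case of equality every nonnegative summand vanishes: either `W i j = 0` or `a i = ψ (b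
    -- j)`. Both give this intertwining relation, which turns the diagonalization of `A` into that
    -- of `cfc ψ B`.
    have hW2 : diagonal a * W = W * diagonal (fun j => ψ (b j)) := by
      ext i j
      rw [diagonal_mul, mul_diagonal]
      have h0 := (Finset.sum_eq_zero_iff_of_nonneg fun j _ => hnn i j).1 (key i (Finset.mem_univ i))
        j (Finset.mem_univ j)
      rcases mul_eq_zero.1 h0 with h1 | h1
      · rw [pow_eq_zero_iff two_ne_zero] at h1
        rw [h1, mul_zero, zero_mul]
      · rw [h' _ (ha i) _ (hb j) (by linarith), mul_comm]
    have hUV : U * W = V := by rw [hWdef, ← Matrix.mul_assoc, hU, Matrix.one_mul]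
    have hVW : W * Vᵀ = Uᵀ := by rw [hWdef, Matrix.mul_assoc, hV, Matrix.mul_one]
    calc A = U * (diagonal a * W) * Vᵀ := by rw [eA, ← hVW]; simp only [Matrix.mul_assoc]
      _ = cfc ψ B := by rw [hW2, ← Matrix.mul_assoc, hUV, hcB]

end SpectralTraces

/-! ### Functions of NᵀN expressed through NNᵀ -/

section Intertwining

open Polynomial

variable {ι κ : Type*} [Fintype ι] [DecidableEq ι] [Fintype κ] [DecidableEq κ]

lemma transpose_mul_aeval (N : Matrix κ ι ℝ) (q : ℝ[X]) :
    aeval (Nᵀ * N) q * Nᵀ = Nᵀ * aeval (N * Nᵀ) q := by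
  induction q using Polynomial.induction_on with
  | C r => simp [Algebra.algebraMap_eq_smul_one]
  | add q₁ q₂ h₁ h₂ => simp only [map_add, Matrix.add_mul, Matrix.mul_add, h₁, h₂]
  | monomial k r h =>
    rw [pow_succ', ← mul_assoc, mul_comm (C r), mul_assoc]
    rw [map_mul, map_mul (aeval (N * Nᵀ)), aeval_X, aeval_X, Matrix.mul_assoc (Nᵀ * N), h]
    simp only [Matrix.mul_assoc]

/-- The factor `X` supplies `Nᵀ * N`; its `Nᵀ` is then pulled to the left through the polynomial,
which becomes one in `N * Nᵀ`. -/
lemma cfc_transpose_mul_self (N : Matrix κ ι ℝ) (ψ : ℝ → ℝ) (q : ℝ[X])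
    (hq : ∀ t ∈ spectrum ℝ (Nᵀ * N), ψ t = (1 + q * X : ℝ[X]).eval t) :
    cfc ψ (Nᵀ * N) = 1 + Nᵀ * aeval (N * Nᵀ) q * N := by
  have hsa : IsSelfAdjoint (Nᵀ * N) := by
    simpa using! isHermitian_conjTranspose_mul_self N
  rw [cfc_congr hq, cfc_polynomial _ _ hsa, map_add, map_one, map_mul, aeval_X,
    ← Matrix.mul_assoc, transpose_mul_aeval]

/-- If `ψ 0 = 1`, then `ψ(Nᵀ N) = 1 + Nᵀ Q N` where `Q` depends on `N Nᵀ` only. -/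
lemma exists_cfc_transpose_mul_self {ι' : Type*} [Fintype ι'] [DecidableEq ι']
    (N : Matrix κ ι ℝ) (N' : Matrix κ ι' ℝ) (h : N * Nᵀ = N' * N'ᵀ) (ψ : ℝ → ℝ) (hψ : ψ 0 = 1) :
    ∃ Q : Matrix κ κ ℝ, cfc ψ (Nᵀ * N) = 1 + Nᵀ * Q * N ∧ cfc ψ (N'ᵀ * N') = 1 + N'ᵀ * Q * N' := by
  set s : Finset ℝ := (Nᵀ * N).finite_real_spectrum.toFinset ∪
    (N'ᵀ * N').finite_real_spectrum.toFinset
  -- Interpolating on the union of both spectra yields one polynomial for both matrices. The junk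
  -- value at `t = 0` is harmless: `q` is multiplied by `X` and `ψ 0 = 1`.
  set q : ℝ[X] := Lagrange.interpolate s id (fun t => (ψ t - 1) / t)
  have hq : ∀ t ∈ s, ψ t = (1 + q * X : ℝ[X]).eval t := by
    intro t ht
    have hqt : q.eval t = (ψ t - 1) / t :=
      Lagrange.eval_interpolate_at_node _ Function.injective_id.injOn ht
    rw [eval_add, eval_mul, eval_one, eval_X, hqt]
    by_cases h0 : t = 0
    · simp [h0, hψ]
    · field_simp
      ring
  refine ⟨aeval (N * Nᵀ) q, cfc_transpose_mul_self N ψ q fun t ht => hq t ?_, ?_⟩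
  · exact Finset.mem_union_left _ (by simpa using ht)
  · rw [h]
    exact cfc_transpose_mul_self N' ψ q fun t ht =>
      hq t (Finset.mem_union_right _ (by simpa using ht))

end Intertwining

/-! ### The spectral norm of NNᵀ bounds NᵀN -/

section SpectralNorm

variable {n : ℕ} {ι : Type*} [Fintype ι]

lemma dotProduct_mulVec_le_specNorm (P : Matrix (Fin n) (Fin n) ℝ) (w : Fin n → ℝ) :
    w ⬝ᵥ P *ᵥ w ≤ specNorm P * (w ⬝ᵥ w) := by
  have h1 := real_inner_le_norm (WithLp.toLp 2 w) (toEuclideanCLM (𝕜 := ℝ) P (WithLp.toLp 2 w))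
  have h2 := (toEuclideanCLM (𝕜 := ℝ) P).le_opNorm (WithLp.toLp 2 w)
  have h3 : w ⬝ᵥ w = ‖WithLp.toLp 2 w‖ * ‖WithLp.toLp 2 w‖ := by
    rw [← sq, EuclideanSpace.real_norm_sq_eq]
    simp [dotProduct, sq]
  have h4 : inner ℝ (WithLp.toLp 2 w) (toEuclideanCLM (𝕜 := ℝ) P (WithLp.toLp 2 w))
      = w ⬝ᵥ P *ᵥ w := by
    rw [inner_toEuclideanCLM]
  rw [h4] at h1
  rw [h3]
  unfold specNorm
  nlinarith [norm_nonneg (WithLp.toLp 2 w)]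

/-- With $w=Nu$, Cauchy–Schwarz gives $|w|^4=(u\cdot
N^Tw)^2\le|u|^2\,|N^Tw|^2\le|u|^2\,\|NN^T\|\,|w|^2$; then divide by $|w|^2$. -/
lemma mulVec_dotProduct_le_specNorm (N : Matrix (Fin n) ι ℝ) (u : ι → ℝ) :
    (N *ᵥ u) ⬝ᵥ (N *ᵥ u) ≤ specNorm (N * Nᵀ) * (u ⬝ᵥ u) := by
  set w := N *ᵥ u with hw
  set v := Nᵀ *ᵥ w with hv
  have h1 : w ⬝ᵥ w = u ⬝ᵥ v := by
    rw [hv, mulVec_transpose, hw, dotProduct_comm u, ← dotProduct_mulVec]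
  have h2 : v ⬝ᵥ v ≤ specNorm (N * Nᵀ) * (w ⬝ᵥ w) := by
    refine le_trans (le_of_eq ?_) (dotProduct_mulVec_le_specNorm _ w)
    rw [hv, ← mulVec_mulVec, mulVec_transpose N w, dotProduct_mulVec]
  have h3 : (u ⬝ᵥ v) ^ 2 ≤ (u ⬝ᵥ u) * (v ⬝ᵥ v) := by
    simpa [dotProduct, sq] using Finset.sum_mul_sq_le_sq_mul_sq Finset.univ u v
  have h4 : 0 ≤ u ⬝ᵥ u := by simpa using dotProduct_star_self_nonneg u
  have h5 : 0 ≤ w ⬝ᵥ w := by simpa using dotProduct_star_self_nonneg w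
  rcases h5.eq_or_lt with h0 | h0
  · rw [← h0]
    exact mul_nonneg (norm_nonneg _) h4
  · rw [← h1] at h3
    have h6 := h3.trans (mul_le_mul_of_nonneg_left h2 h4)
    refine le_of_mul_le_mul_right ?_ h0
    nlinarith

lemma spectrum_transpose_mul_self_le [DecidableEq ι] (N : Matrix (Fin n) ι ℝ) {t : ℝ}
    (ht : t ∈ spectrum ℝ (Nᵀ * N)) : t ≤ specNorm (N * Nᵀ) := by
  rw [← spectrum_toLin', ← Module.End.hasEigenvalue_iff_mem_spectrum] at ht
  obtain ⟨u, hu⟩ := ht.exists_hasEigenvector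
  have h1 := hu.apply_eq_smul
  rw [toLin'_apply] at h1
  have h2 : (N *ᵥ u) ⬝ᵥ (N *ᵥ u) = t * (u ⬝ᵥ u) := by
    rw [dotProduct_mulVec, ← mulVec_transpose, mulVec_mulVec, h1, smul_dotProduct, smul_eq_mul]
  have h3 : 0 < u ⬝ᵥ u := by simpa using dotProduct_star_self_pos_iff.2 hu.2
  exact le_of_mul_le_mul_right (h2 ▸ mulVec_dotProduct_le_specNorm N u) h3

end SpectralNorm

/-! ### The scalar maximization -/

section Scalar

open Classical in
/-- The scalar function whose trace is the covariance part of the `τ`-divergence. -/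
def divFun (τ s : ℝ) : ℝ :=
  if τ = 0 then -Real.log s + s - 1
  else if τ = 1 then s * Real.log s - s + 1
  else -(1 / (τ * (1 - τ)) * s ^ τ) + 1 / (1 - τ) * s + 1 / τ

open Classical in
/-- The inverse of the derivative of `divFun τ`. -/
def tiltFun (τ t : ℝ) : ℝ :=
  if τ = 1 then Real.exp t else (1 - (1 - τ) * t) ^ (1 / (τ - 1))

lemma tiltFun_zero (τ : ℝ) : tiltFun τ 0 = 1 := by
  unfold tiltFun; split_ifs <;> simp

lemma tiltFun_pos {τ t : ℝ} (ht : (1 - τ) * t < 1) : 0 < tiltFun τ t := by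
  unfold tiltFun
  split_ifs
  · exact Real.exp_pos t
  · exact Real.rpow_pos_of_pos (by linarith) _

/-- Since `b` is the derivative of `divFun τ` at `s₀ = tiltFun τ b`, the gap is the amount by which
the strictly convex `divFun τ` exceeds its tangent at `s₀`. In the ratio `s / s₀` it reduces to
$\log x<x-1$ at the endpoints and to Bernoulli's inequality for `0 < τ < 1`. -/
lemma divFun_gap_pos {τ b s : ℝ} (hτ0 : 0 ≤ τ) (hτ1 : τ ≤ 1) (hb : (1 - τ) * b < 1) (hs : 0 < s)
    (hne : s ≠ tiltFun τ b) :
    s * b - divFun τ s < tiltFun τ b * b - divFun τ (tiltFun τ b) := by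
  have hpos := tiltFun_pos hb
  set s₀ := tiltFun τ b with hs₀
  have hr : 0 < s / s₀ := div_pos hs hpos
  have hr1 : s / s₀ ≠ 1 := fun h => hne ((div_eq_one_iff_eq hpos.ne').1 h)
  have hsr : s = s₀ * (s / s₀) := by field_simp
  rcases hτ1.eq_or_lt with rfl | hτ1
  · have hb' : b = Real.log s₀ := by simp [hs₀, tiltFun]
    -- The logarithmic inequality is taken at `s₀ / s`, since the gap at `τ = 1` is `s₀ - s + s log
    -- (s / s₀)`.
    have h1 := Real.log_lt_sub_one_of_pos (inv_pos.2 hr) (inv_ne_one.2 hr1)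
    have h2 : Real.log s = Real.log s₀ + Real.log (s / s₀) := by
      rw [Real.log_div hs.ne' hpos.ne']; ring
    rw [Real.log_inv] at h1
    have h3 := mul_lt_mul_of_pos_left h1 hs
    have h4 : s * (s / s₀)⁻¹ = s₀ := by field_simp
    simp only [divFun, one_ne_zero, if_false, if_true]
    rw [h2, ← hb']
    rw [mul_sub, h4] at h3
    linarith
  have hτ1' : τ ≠ 1 := hτ1.ne
  have hb' : b = (1 - s₀ ^ (τ - 1)) / (1 - τ) := by
    have : s₀ ^ (τ - 1) = 1 - (1 - τ) * b := by
      rw [hs₀, tiltFun, if_neg hτ1', ← Real.rpow_mul (by linarith),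
        one_div_mul_cancel (by linarith), Real.rpow_one]
    rw [this]
    have : 1 - τ ≠ 0 := by linarith
    field_simp
    ring
  rcases hτ0.eq_or_lt with rfl | hτ0
  · have h1 := Real.log_lt_sub_one_of_pos hr hr1
    have h2 : Real.log s = Real.log s₀ + Real.log (s / s₀) := by
      rw [Real.log_div hs.ne' hpos.ne']; ring
    have hb2 : b = 1 - s₀⁻¹ := by rw [hb', zero_sub, Real.rpow_neg_one]; ring
    simp only [divFun, if_true]
    rw [h2, hb2]
    have h4 : s₀ * s₀⁻¹ = 1 := by field_simp
    have h5 : s * s₀⁻¹ = s / s₀ := by rw [div_eq_mul_inv]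
    linarith
  · have h1 := _root_.rpow_one_add_lt_one_add_mul_self (s := s / s₀ - 1) (by linarith)
      (sub_ne_zero.2 hr1) hτ0 hτ1
    rw [add_sub_cancel] at h1
    have h2 : s ^ τ = s₀ ^ τ * (s / s₀) ^ τ := by
      rw [← Real.mul_rpow hpos.le hr.le, ← hsr]
    have h3 : s₀ ^ (τ - 1) = s₀ ^ τ / s₀ := by rw [Real.rpow_sub hpos, Real.rpow_one]
    have h4 : 0 < s₀ ^ τ := Real.rpow_pos_of_pos hpos _
    simp only [divFun, hτ0.ne', hτ1', if_false]
    rw [h2, hb', h3]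
    have h5 : (0 : ℝ) < 1 - τ := by linarith
    have h6 : (s₀ * ((1 - s₀ ^ τ / s₀) / (1 - τ))
          - (-(1 / (τ * (1 - τ)) * s₀ ^ τ) + 1 / (1 - τ) * s₀ + 1 / τ))
        - (s * ((1 - s₀ ^ τ / s₀) / (1 - τ))
          - (-(1 / (τ * (1 - τ)) * (s₀ ^ τ * (s / s₀) ^ τ)) + 1 / (1 - τ) * s + 1 / τ))
        = s₀ ^ τ / (τ * (1 - τ)) * (1 + τ * (s / s₀ - 1) - (s / s₀) ^ τ) := by
      field_simp
      ring
    have h7 : 0 < s₀ ^ τ / (τ * (1 - τ)) * (1 + τ * (s / s₀ - 1) - (s / s₀) ^ τ) :=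
      mul_pos (by positivity) (by linarith)
    linarith

end Scalar

/-! ### The divergence in normalized coordinates -/

section Divergence

variable {ι : Type*} [Fintype ι] [DecidableEq ι]

lemma isUnit_of_mul_transpose {L K : Matrix ι ι ℝ} (hK : K.PosDef) (hL : L * Lᵀ = K) :
    IsUnit L.det := by
  have h := hK.det_pos.ne'
  rw [← hL, det_mul] at h
  exact (left_ne_zero_of_mul h).isUnit

lemma posDef_conj {L K : Matrix ι ι ℝ} (hL : IsUnit L.det) (hK : K.PosDef) : (L * K * Lᵀ).PosDef := by
  have := hK.mul_mul_conjTranspose_same (B := L)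
    (vecMul_injective_of_isUnit ((isUnit_iff_isUnit_det L).2 hL))
  rwa [conjTranspose_eq_transpose_of_trivial] at this

lemma posDef_normalizedCov {L K' : Matrix ι ι ℝ} (hL : IsUnit L.det) (hK' : K'.PosDef) :
    (normalizedCov L K').PosDef :=
  posDef_conj ((isUnit_nonsing_inv_det_iff).2 hL) hK'

lemma mul_normalizedCov_mul {L : Matrix ι ι ℝ} (hL : IsUnit L.det) (K' : Matrix ι ι ℝ) :
    L * normalizedCov L K' * Lᵀ = K' := by
  have h : (L⁻¹)ᵀ * Lᵀ = 1 := by rw [← transpose_mul, mul_nonsing_inv _ hL, transpose_one]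
  rw [normalizedCov, ← Matrix.mul_assoc, ← Matrix.mul_assoc, mul_nonsing_inv _ hL, Matrix.one_mul,
    Matrix.mul_assoc, h, Matrix.mul_one]

lemma normalizedCov_mul {L : Matrix ι ι ℝ} (hL : IsUnit L.det) (S : Matrix ι ι ℝ) :
    normalizedCov L (L * S * Lᵀ) = S := by
  have h : Lᵀ * (L⁻¹)ᵀ = 1 := by rw [← transpose_mul, nonsing_inv_mul _ hL, transpose_one]
  rw [normalizedCov, ← Matrix.mul_assoc, ← Matrix.mul_assoc, nonsing_inv_mul _ hL, Matrix.one_mul,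
    Matrix.mul_assoc, h, Matrix.mul_one]

lemma inv_of_mul_transpose {L K : Matrix ι ι ℝ} (h : L * Lᵀ = K) : K⁻¹ = (L⁻¹)ᵀ * L⁻¹ := by
  rw [← h, Matrix.mul_inv_rev, transpose_nonsing_inv]

lemma trace_mul_inv_eq {L K : Matrix ι ι ℝ} (h : L * Lᵀ = K) (K' : Matrix ι ι ℝ) :
    trace (K' * K⁻¹) = trace (normalizedCov L K') := by
  rw [inv_of_mul_transpose h, normalizedCov, Matrix.mul_assoc, trace_mul_comm (L⁻¹),
    Matrix.mul_assoc]

lemma weightedSq_inv {L K : Matrix ι ι ℝ} (h : L * Lᵀ = K) (c : ℝ) (v : EuclideanSpace ℝ ι) :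
    weightedSq (c • K⁻¹) v = c * ((L⁻¹ *ᵥ v.ofLp) ⬝ᵥ (L⁻¹ *ᵥ v.ofLp)) := by
  rw [weightedSq, inv_of_mul_transpose h, smul_mulVec, dotProduct_smul, smul_eq_mul,
    ← mulVec_mulVec, mulVec_transpose, dotProduct_comm, ← dotProduct_mulVec]

/-- The real-valued form of the `τ`-divergence. At `τ = 1` the coefficient of the first term is `0`;
the two agree there for densities with the same mean, see `tauDiv_eq_realDiv`. -/
def realDiv (τ : ℝ) (L : Matrix ι ι ℝ) (f' f : GaussianDensity ι) : ℝ :=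
  1 / (1 - τ) * ((L⁻¹ *ᵥ (f'.mean - f.mean).ofLp) ⬝ᵥ (L⁻¹ *ᵥ (f'.mean - f.mean).ofLp))
    + trace (cfc (divFun τ) (normalizedCov L f'.cov))

lemma trace_cfc_divFun {S : Matrix ι ι ℝ} (hS : S.IsHermitian) (τ : ℝ) :
    trace (cfc (divFun τ) S) =
      if τ = 0 then -trace (cfc Real.log S) + trace S - trace (1 : Matrix ι ι ℝ)
      else if τ = 1 then trace (S * cfc Real.log S) - trace S + trace (1 : Matrix ι ι ℝ)
      else -(1 / (τ * (1 - τ)) * trace (cfc (fun t : ℝ => t ^ τ) S)) + 1 / (1 - τ) * trace S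
        + 1 / τ * trace (1 : Matrix ι ι ℝ) := by
  obtain ⟨U, a, hU, hU', ha, hc⟩ := exists_diagonalization hS
  have ht (g : ℝ → ℝ) : trace (cfc g S) = ∑ i, g (a i) := by
    rw [hc, Matrix.mul_assoc, trace_mul_comm, Matrix.mul_assoc, hU', Matrix.mul_one, trace_diagonal]
  have hS1 : trace S = ∑ i, a i := by
    have := ht id
    rwa [cfc_id ℝ S hS.isSelfAdjoint] at this
  have h1 : trace (1 : Matrix ι ι ℝ) = ∑ _i : ι, (1 : ℝ) := by simp
  have hlog : S * cfc Real.log S = cfc (fun t => t * Real.log t) S := by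
    rw [cfc_mul (fun t => t) Real.log S (continuousOn_spectrum S _) (continuousOn_spectrum S _),
      cfc_id' ℝ S hS.isSelfAdjoint]
  rw [hlog, ht, ht, ht, ht, hS1, h1]
  split_ifs with h0 h0'
  · simp only [divFun, h0, if_true, Finset.sum_add_distrib, Finset.sum_sub_distrib,
      Finset.sum_neg_distrib]
  · simp only [divFun, h0', one_ne_zero, if_true, if_false, Finset.sum_add_distrib,
      Finset.sum_sub_distrib]
  · simp only [divFun, h0, h0', if_false, Finset.sum_add_distrib, Finset.sum_neg_distrib,
      Finset.mul_sum, mul_one]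

lemma tauDiv_eq_realDiv {τ : ℝ} {L : Matrix ι ι ℝ} {f' f : GaussianDensity ι}
    (hL : L * Lᵀ = f.cov) (h : τ = 1 → f'.mean = f.mean) :
    tauDiv τ L f' f = (realDiv τ L f' f : EReal) := by
  have hLu := isUnit_of_mul_transpose f.posDef hL
  have hS := (posDef_normalizedCov hLu f'.posDef).isHermitian
  -- Similarity invariance replaces the nonsymmetric logarithm in the case `τ = 0` by the symmetric
  -- one.
  have hsim (X : Matrix ι ι ℝ) : trace (L * X * L⁻¹) = trace X := by
    rw [trace_mul_comm, ← Matrix.mul_assoc, nonsing_inv_mul _ hLu, Matrix.one_mul]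
  unfold tauDiv realDiv
  rw [trace_cfc_divFun hS]
  split_ifs with h0 h1 h2
  · rw [trace_sub, trace_add, trace_neg, hsim, trace_mul_inv_eq hL, ← weightedSq_inv hL, h0]
    simp [matFun]
  · rw [trace_add, trace_sub, trace_mul_inv_eq hL, h1]
    simp [matFun]
  · exact absurd (sub_eq_zero.2 (h h1)) h2
  · rw [trace_add, trace_add, trace_neg, trace_smul, trace_smul, trace_smul, trace_mul_inv_eq hL,
      ← weightedSq_inv hL]
    simp [matFun]

/-- The $\delta_\infty$ term at `τ = 1` is the only one that can be infinite. -/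
lemma mem_uncertaintySet_iff {τ : ℝ} {L : Matrix ι ι ℝ} {f' f : GaussianDensity ι}
    (hL : L * Lᵀ = f.cov) :
    f' ∈ uncertaintySet τ L f ↔ (τ = 1 → f'.mean = f.mean) := by
  constructor
  · rintro h rfl
    by_contra hne
    have h' : tauDiv 1 L f' f < ⊤ := h
    rw [tauDiv, if_neg one_ne_zero, if_pos rfl, if_neg (sub_ne_zero.2 hne), EReal.top_add_coe] at h'
    exact lt_irrefl _ h'
  · intro h
    change tauDiv τ L f' f < ⊤
    rw [tauDiv_eq_realDiv hL h]
    exact EReal.coe_lt_top _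

end Divergence

/-! ### The least favorable density and the optimal estimator -/

section WorstCase

variable {n p : ℕ}

lemma isHermitian_transpose_mul_self {ι κ : Type*} [Fintype κ] (N : Matrix κ ι ℝ) :
    (Nᵀ * N).IsHermitian := by
  simpa using! isHermitian_conjTranspose_mul_self N

lemma perturbedCov_eq (τ θ : ℝ) (L : Matrix (Fin n) (Fin n) ℝ) :
    perturbedCov τ θ L = L * cfc (fun t => tiltFun τ (θ * t)) (Lᵀ * L) * Lᵀ := by
  have hM := isHermitian_transpose_mul_self L
  unfold perturbedCov tiltFun matFun
  split_ifs with h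
  · rw [← cfc_const_mul_id θ (Lᵀ * L) hM.isSelfAdjoint, cfc_comp_of_isHermitian hM]
  · have : 1 - (θ * (1 - τ)) • (Lᵀ * L) = cfc (fun t => 1 - (θ * (1 - τ)) * t) (Lᵀ * L) := by
      rw [cfc_sub (fun _ => 1) _ (Lᵀ * L) (continuousOn_spectrum _ _) (continuousOn_spectrum _ _),
        cfc_const_one ℝ _ hM.isSelfAdjoint, cfc_const_mul_id _ _ hM.isSelfAdjoint]
    rw [this, cfc_comp_of_isHermitian hM]
    congr 3
    ext t
    ring_nf

/-- The zero block says that the error is uncorrelated with y. It does not involve `Kx`, so the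
identity serves both the nominal and the least favorable covariance. -/
lemma errorMatrix_mul_fromBlocks {Kxy : Matrix (Fin n) (Fin p) ℝ} {Ky : Matrix (Fin p) (Fin p) ℝ}
    (hKy : IsUnit Ky.det) (Kx : Matrix (Fin n) (Fin n) ℝ) (Kyx : Matrix (Fin p) (Fin n) ℝ) :
    errorMatrix Kxy Ky * fromBlocks Kx Kxy Kyx Ky
      = fromCols (posteriorCov Kx Kxy Kyx Ky) 0 := by
  rw [errorMatrix, fromCols_mul_fromBlocks, posteriorCov]
  congr 1
  · rw [Matrix.one_mul, Matrix.neg_mul, sub_eq_add_neg]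
  · rw [Matrix.one_mul, Matrix.neg_mul, Matrix.mul_assoc, nonsing_inv_mul _ hKy, Matrix.mul_one,
      add_neg_cancel]

lemma fromCols_mul_errorMatrix_transpose (P : Matrix (Fin n) (Fin n) ℝ)
    (Kxy : Matrix (Fin n) (Fin p) ℝ) (Ky : Matrix (Fin p) (Fin p) ℝ) :
    fromCols P (0 : Matrix (Fin n) (Fin p) ℝ) * (errorMatrix Kxy Ky)ᵀ = P := by
  rw [errorMatrix, transpose_fromCols, fromCols_mul_fromRows, transpose_one, Matrix.mul_one,
    Matrix.zero_mul, add_zero]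

lemma mse_bayes (f' : GaussianDensity (Fin n ⊕ Fin p)) (m : EuclideanSpace ℝ (Fin n ⊕ Fin p))
    (Kxy : Matrix (Fin n) (Fin p) ℝ) (Ky : Matrix (Fin p) (Fin p) ℝ) :
    mse f' (bayes m Kxy Ky)
      = ‖WithLp.toLp 2 (errorMatrix Kxy Ky *ᵥ (f'.mean - m).ofLp)‖ ^ 2
        + trace (errorMatrix Kxy Ky * f'.cov * (errorMatrix Kxy Ky)ᵀ) := by
  simp_rw [mse, xPart_sub_bayes]
  exact integral_norm_sq_mulVec f' _ m

/-- The maximum over covariance matrices. -/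
lemma trace_mul_sub_trace_divFun {ι : Type*} [Fintype ι] [DecidableEq ι] {τ : ℝ} (hτ0 : 0 ≤ τ)
    (hτ1 : τ ≤ 1) {B : Matrix ι ι ℝ} (hB : B.IsHermitian)
    (hb : ∀ b ∈ spectrum ℝ B, (1 - τ) * b < 1) {S : Matrix ι ι ℝ} (hS : S.PosDef) :
    trace (S * B) - trace (cfc (divFun τ) S)
        ≤ trace (cfc (tiltFun τ) B * B) - trace (cfc (divFun τ) (cfc (tiltFun τ) B)) ∧
      (trace (S * B) - trace (cfc (divFun τ) S)
        = trace (cfc (tiltFun τ) B * B) - trace (cfc (divFun τ) (cfc (tiltFun τ) B)) →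
        S = cfc (tiltFun τ) B) := by
  have hmax : trace (cfc (tiltFun τ) B * B) - trace (cfc (divFun τ) (cfc (tiltFun τ) B))
      = trace (cfc (fun b => tiltFun τ b * b - divFun τ (tiltFun τ b)) B) := by
    rw [cfc_sub _ _ B (continuousOn_spectrum _ _) (continuousOn_spectrum _ _),
      cfc_mul _ _ B (continuousOn_spectrum _ _) (continuousOn_spectrum _ _),
      cfc_id' ℝ B hB.isSelfAdjoint, cfc_comp_of_isHermitian hB, trace_sub]
  have hpos : ∀ s ∈ spectrum ℝ S, 0 < s := by
    intro s hs
    rw [hS.isHermitian.spectrum_real_eq_range_eigenvalues] at hs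
    obtain ⟨i, rfl⟩ := hs
    exact hS.eigenvalues_pos i
  rw [hmax]
  refine trace_fenchel hS.isHermitian hB _ _ _ (fun s hs b hb' => ?_) fun s hs b hb' h => ?_
  · rcases eq_or_ne s (tiltFun τ b) with rfl | hne
    · exact le_rfl
    · exact (divFun_gap_pos hτ0 hτ1 (hb b hb') (hpos s hs) hne).le
  · by_contra hne
    exact (divFun_gap_pos hτ0 hτ1 (hb b hb') (hpos s hs) hne).ne h

lemma posDef_cfc {ι : Type*} [Fintype ι] [DecidableEq ι] {B : Matrix ι ι ℝ} (hB : B.IsHermitian)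
    {ψ : ℝ → ℝ} (h : ∀ b ∈ spectrum ℝ B, 0 < ψ b) : (cfc ψ B).PosDef := by
  obtain ⟨U, b, hU, hU', hb, hc⟩ := exists_diagonalization hB
  rw [hc]
  exact posDef_conj (isUnit_det_of_right_inverse hU) (PosDef.diagonal fun i => h _ (hb i))

/-- This is where the bound on `θ` enters the covariance part: it keeps the spectrum where `tiltFun
τ` is positive and inverts the derivative of `divFun τ`. -/
lemma spectrum_smul_transpose_mul_self {ι : Type*} [Fintype ι] [DecidableEq ι] {τ θ : ℝ}
    (hτ1 : τ ≤ 1) (hθ : 0 < θ) (N : Matrix (Fin n) ι ℝ) (hN : (1 - τ) * specNorm (N * Nᵀ) < θ⁻¹) :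
    ∀ b ∈ spectrum ℝ (θ • (Nᵀ * N)), (1 - τ) * b < 1 := by
  intro b hb
  have hM := isHermitian_transpose_mul_self N
  rw [← cfc_const_mul_id θ (Nᵀ * N) hM.isSelfAdjoint,
    cfc_map_spectrum _ (Nᵀ * N) hM.isSelfAdjoint (continuousOn_spectrum _ _)] at hb
  obtain ⟨t, ht, rfl⟩ := hb
  have h1 := mul_le_mul_of_nonneg_left (spectrum_transpose_mul_self_le N ht) (sub_nonneg.2 hτ1)
  have h2 := mul_lt_mul_of_pos_left (h1.trans_lt hN) hθ
  rw [mul_inv_cancel₀ hθ.ne'] at h2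
  calc (1 - τ) * (θ * t) = θ * ((1 - τ) * t) := by ring
    _ < 1 := h2

lemma penalized_eq {τ θ : ℝ} {L : Matrix (Fin n ⊕ Fin p) (Fin n ⊕ Fin p) ℝ}
    {f f' : GaussianDensity (Fin n ⊕ Fin p)} (hL : L * Lᵀ = f.cov)
    (h : f' ∈ uncertaintySet τ L f)
    (g : EuclideanSpace ℝ (Fin p) → EuclideanSpace ℝ (Fin n)) :
    penalized τ θ L f f' g = ((mse f' g - θ⁻¹ * realDiv τ L f' f : ℝ) : EReal) := by
  rw [penalized, tauDiv_eq_realDiv hL ((mem_uncertaintySet_iff hL).1 h)]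
  norm_cast

/-- For the nominal Bayes estimator, the worst case over the uncertainty set is the density with
the nominal mean and the covariance matrix `L ψ(θ Nᵀ N) Lᵀ`, `N = [I, -K_xy K_y⁻¹] L`. -/
lemma mse_sub_realDiv_le {τ θ : ℝ} (hτ0 : 0 ≤ τ) (hτ1 : τ ≤ 1) (hθ : 0 < θ)
    {L : Matrix (Fin n ⊕ Fin p) (Fin n ⊕ Fin p) ℝ} {f f₀ f' : GaussianDensity (Fin n ⊕ Fin p)}
    (hL : L * Lᵀ = f.cov) {Kxy : Matrix (Fin n) (Fin p) ℝ} {Ky : Matrix (Fin p) (Fin p) ℝ}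
    (hP : (1 - τ) * specNorm (errorMatrix Kxy Ky * f.cov * (errorMatrix Kxy Ky)ᵀ) < θ⁻¹)
    (hm₀ : f₀.mean = f.mean)
    (hc₀ : f₀.cov = L * cfc (tiltFun τ)
      (θ • ((errorMatrix Kxy Ky * L)ᵀ * (errorMatrix Kxy Ky * L))) * Lᵀ)
    (hf' : f' ∈ uncertaintySet τ L f) :
    mse f' (bayes f.mean Kxy Ky) - θ⁻¹ * realDiv τ L f' f
        ≤ mse f₀ (bayes f.mean Kxy Ky) - θ⁻¹ * realDiv τ L f₀ f ∧
      (mse f' (bayes f.mean Kxy Ky) - θ⁻¹ * realDiv τ L f' f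
        = mse f₀ (bayes f.mean Kxy Ky) - θ⁻¹ * realDiv τ L f₀ f → f' = f₀) := by
  set E := errorMatrix Kxy Ky
  set N := E * L with hN
  set B := θ • (Nᵀ * N) with hB
  have hLu := isUnit_of_mul_transpose f.posDef hL
  have hNN : N * Nᵀ = E * f.cov * Eᵀ := by
    rw [hN, transpose_mul, ← hL]; simp only [Matrix.mul_assoc]
  rw [← hNN] at hP
  have hBh : B.IsHermitian := by
    have := isHermitian_transpose_mul_self N
    rw [IsHermitian, hB, conjTranspose_smul, this.eq, star_trivial]
  -- The objective decouples: the first summand depends on the mean only, the second on the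
  -- covariance only.
  have hval (f' : GaussianDensity (Fin n ⊕ Fin p)) :
      mse f' (bayes f.mean Kxy Ky) - θ⁻¹ * realDiv τ L f' f
        = ((N *ᵥ (L⁻¹ *ᵥ (f'.mean - f.mean).ofLp)) ⬝ᵥ (N *ᵥ (L⁻¹ *ᵥ (f'.mean - f.mean).ofLp))
          - θ⁻¹ * (1 / (1 - τ) *
            ((L⁻¹ *ᵥ (f'.mean - f.mean).ofLp) ⬝ᵥ (L⁻¹ *ᵥ (f'.mean - f.mean).ofLp))))
        + θ⁻¹ * (trace (normalizedCov L f'.cov * B)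
          - trace (cfc (divFun τ) (normalizedCov L f'.cov))) := by
    have h1 : trace (E * f'.cov * Eᵀ) = θ⁻¹ * trace (normalizedCov L f'.cov * B) := by
      have : E * f'.cov * Eᵀ = N * (normalizedCov L f'.cov * Nᵀ) := by
        conv_lhs => rw [← mul_normalizedCov_mul hLu f'.cov]
        rw [hN, transpose_mul]; simp only [Matrix.mul_assoc]
      rw [this, trace_mul_comm, hB, Matrix.mul_smul, trace_smul, smul_eq_mul, ← mul_assoc,
        inv_mul_cancel₀ hθ.ne', one_mul, Matrix.mul_assoc]
    have h2 : E *ᵥ (f'.mean - f.mean).ofLp = N *ᵥ (L⁻¹ *ᵥ (f'.mean - f.mean).ofLp) := by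
      rw [mulVec_mulVec, hN, Matrix.mul_assoc, mul_nonsing_inv _ hLu, Matrix.mul_one]
    rw [mse_bayes, h1, h2, realDiv, EuclideanSpace.real_norm_sq_eq]
    simp only [dotProduct, sq]
    ring
  have hn₀ : normalizedCov L f₀.cov = cfc (tiltFun τ) B := by rw [hc₀, normalizedCov_mul hLu]
  set u := L⁻¹ *ᵥ (f'.mean - f.mean).ofLp with hu
  have hu0 : u = 0 → f'.mean = f.mean := by
    intro h
    have h2 : L *ᵥ u = (f'.mean - f.mean).ofLp := by
      rw [hu, mulVec_mulVec, mul_nonsing_inv _ hLu, one_mulVec]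
    rw [h, mulVec_zero] at h2
    exact sub_eq_zero.1 (WithLp.ofLp_injective 2 h2.symm)
  have hmean : u ≠ 0 → (N *ᵥ u) ⬝ᵥ (N *ᵥ u) - θ⁻¹ * (1 / (1 - τ) * (u ⬝ᵥ u)) < 0 := by
    intro hne
    -- For `τ = 1` membership in the uncertainty set already forces `u = 0`.
    have hτ : τ < 1 := lt_of_le_of_ne hτ1 fun h => hne <| by
      rw [hu, (mem_uncertaintySet_iff hL).1 hf' h, sub_self, WithLp.ofLp_zero, mulVec_zero]
    have huu : 0 < u ⬝ᵥ u := by simpa using dotProduct_star_self_pos_iff.2 hne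
    have h1 := mulVec_dotProduct_le_specNorm N u
    have h2 : specNorm (N * Nᵀ) < θ⁻¹ * (1 / (1 - τ)) := by
      rw [mul_one_div, lt_div_iff₀ (sub_pos.2 hτ), mul_comm]
      exact hP
    have h3 := mul_lt_mul_of_pos_right h2 huu
    rw [← mul_assoc]
    linarith
  have hmean' : (N *ᵥ u) ⬝ᵥ (N *ᵥ u) - θ⁻¹ * (1 / (1 - τ) * (u ⬝ᵥ u)) ≤ 0 := by
    by_cases h : u = 0
    · simp [h]
    · exact (hmean h).le
  have hcov := trace_mul_sub_trace_divFun hτ0 hτ1 hBh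
    (spectrum_smul_transpose_mul_self hτ1 hθ N hP) (posDef_normalizedCov hLu f'.posDef)
  have hcov' := mul_le_mul_of_nonneg_left hcov.1 (inv_pos.2 hθ).le
  have hval₀ := hval f₀
  rw [hm₀, sub_self, WithLp.ofLp_zero, mulVec_zero, mulVec_zero, dotProduct_zero, dotProduct_zero,
    mul_zero, mul_zero, sub_zero, zero_add, hn₀] at hval₀
  rw [hval₀, hval f', ← hu]
  refine ⟨by linarith, fun heq => ?_⟩
  -- Both parts are bounded separately by their maxima, so equality of the sums forces equality in
  -- each.
  have hu' : u = 0 := by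
    by_contra hne
    linarith [hmean hne]
  have hS : normalizedCov L f'.cov = cfc (tiltFun τ) B := by
    apply hcov.2
    rw [hu'] at heq
    simp only [mulVec_zero, dotProduct_zero, mul_zero, sub_zero, zero_add] at heq
    exact mul_left_cancel₀ (inv_pos.2 hθ).ne' heq
  ext1
  · rw [hu0 hu', hm₀]
  · rw [hc₀, ← hS, mul_normalizedCov_mul hLu]

/-- The covariance matrix of the least favorable density. -/
lemma exists_worst_cov {τ θ : ℝ} {Kx : Matrix (Fin n) (Fin n) ℝ} {Kxy : Matrix (Fin n) (Fin p) ℝ}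
    {Kyx : Matrix (Fin p) (Fin n) ℝ} {Ky : Matrix (Fin p) (Fin p) ℝ}
    (hKy : IsUnit Ky.det)
    {L : Matrix (Fin n ⊕ Fin p) (Fin n ⊕ Fin p) ℝ} (hL : L * Lᵀ = fromBlocks Kx Kxy Kyx Ky)
    {LP : Matrix (Fin n) (Fin n) ℝ} (hLP : LP * LPᵀ = posteriorCov Kx Kxy Kyx Ky) :
    ∃ Kx', L * cfc (tiltFun τ) (θ • ((errorMatrix Kxy Ky * L)ᵀ * (errorMatrix Kxy Ky * L))) * Lᵀ
        = fromBlocks Kx' Kxy Kyx Ky ∧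
      posteriorCov Kx' Kxy Kyx Ky = perturbedCov τ θ LP := by
  set E := errorMatrix Kxy Ky
  set N := E * L with hN
  set P := posteriorCov Kx Kxy Kyx Ky with hPdef
  have hNL : N * Lᵀ = fromCols P 0 := by
    rw [hN, Matrix.mul_assoc, hL, errorMatrix_mul_fromBlocks hKy]
  have hNN : N * Nᵀ = LP * LPᵀ := by
    conv_lhs => rw [hN, transpose_mul, ← Matrix.mul_assoc, ← hN, hNL]
    rw [fromCols_mul_errorMatrix_transpose, hLP]
  have hPt : Pᵀ = P := by rw [← hLP, transpose_mul, transpose_transpose]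
  -- `N` and `LP` have different widths but the same product `P` with their transposes, so one `Q`
  -- serves both.
  obtain ⟨Q, h1, h2⟩ := exists_cfc_transpose_mul_self N LP hNN (fun t => tiltFun τ (θ * t))
    (by simp [tiltFun_zero])
  have hM := isHermitian_transpose_mul_self N
  -- The correction $L N^TQN L^T$ is $P$ stacked on $0$, times $Q$, times $[P,0]$: it is $PQP$ in
  -- the x block and zero elsewhere.
  refine ⟨Kx + P * Q * P, ?_, ?_⟩
  · rw [← cfc_const_mul_id θ (Nᵀ * N) hM.isSelfAdjoint, cfc_comp_of_isHermitian hM, h1,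
      Matrix.mul_add, Matrix.add_mul, Matrix.mul_one, hL]
    have hLN : L * Nᵀ = fromRows P 0 := by
      have := congrArg transpose hNL
      rwa [transpose_mul, transpose_transpose, transpose_fromCols, hPt, transpose_zero] at this
    have : L * (Nᵀ * Q * N) * Lᵀ = (L * Nᵀ) * Q * (N * Lᵀ) := by simp only [Matrix.mul_assoc]
    rw [this, hLN, hNL, fromRows_mul, fromRows_mul_fromCols, fromBlocks_add]
    simp
  · rw [perturbedCov_eq, h2, Matrix.mul_add, Matrix.add_mul, Matrix.mul_one, hLP]
    have : LP * (LPᵀ * Q * LP) * LPᵀ = (LP * LPᵀ) * Q * (LP * LPᵀ) := by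
      simp only [Matrix.mul_assoc]
    rw [this, hLP, hPdef, posteriorCov, posteriorCov]
    abel

lemma bayes_mem_estimators (B : Set (GaussianDensity (Fin n ⊕ Fin p)))
    (m : EuclideanSpace ℝ (Fin n ⊕ Fin p)) (Kxy : Matrix (Fin n) (Fin p) ℝ)
    (Ky : Matrix (Fin p) (Fin p) ℝ) : bayes m Kxy Ky ∈ estimators B :=
  ⟨measurable_bayes m Kxy Ky, fun f' _ =>
    (memLp_two_iff_integrable_sq_norm (memLp_bayes f' m Kxy Ky).1).1 (memLp_bayes f' m Kxy Ky)⟩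

lemma memLp_bayes_sub {f : GaussianDensity (Fin n ⊕ Fin p)}
    {g : EuclideanSpace ℝ (Fin p) → EuclideanSpace ℝ (Fin n)} (hg : Measurable g)
    (hi : Integrable (fun z => ‖g (yPart z)‖ ^ 2) f.law) (m : EuclideanSpace ℝ (Fin n ⊕ Fin p))
    (Kxy : Matrix (Fin n) (Fin p) ℝ) (Ky : Matrix (Fin p) (Fin p) ℝ) :
    MemLp (fun z => (bayes m Kxy Ky - g) (yPart z)) 2 f.law :=
  (memLp_bayes f m Kxy Ky).sub ((memLp_two_iff_integrable_sq_norm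
    (hg.comp measurable_yPart).aestronglyMeasurable).2 hi)

/-- Orthogonality of the error of the Bayes estimator. -/
lemma mse_eq_add {f : GaussianDensity (Fin n ⊕ Fin p)} {Kxy : Matrix (Fin n) (Fin p) ℝ}
    {Ky : Matrix (Fin p) (Fin p) ℝ} (hA : (errorMatrix Kxy Ky * f.cov).toCols₂ = 0)
    {g : EuclideanSpace ℝ (Fin p) → EuclideanSpace ℝ (Fin n)} (hg : Measurable g)
    (hi : Integrable (fun z => ‖g (yPart z)‖ ^ 2) f.law) :
    mse f g = mse f (bayes f.mean Kxy Ky)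
      + ∫ z, ‖(bayes f.mean Kxy Ky - g) (yPart z)‖ ^ 2 ∂f.law := by
  have h (z : EuclideanSpace ℝ (Fin n ⊕ Fin p)) : xPart z - g (yPart z)
      = WithLp.toLp 2 (errorMatrix Kxy Ky *ᵥ (z - f.mean).ofLp)
        + (bayes f.mean Kxy Ky - g) (yPart z) := by
    rw [← xPart_sub_bayes]; simp
  simp_rw [mse, xPart_sub_bayes, h]
  exact integral_norm_sq_error_add f _ hA _ ((measurable_bayes _ _ _).sub hg)
    (memLp_bayes_sub hg hi _ _ _)

/-- The integral gives equality almost everywhere for the law of y, and Lebesgue measure is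
absolutely continuous with respect to that law. -/
lemma ae_eq_of_integral_eq_zero {f : GaussianDensity (Fin n ⊕ Fin p)}
    {g g₀ : EuclideanSpace ℝ (Fin p) → EuclideanSpace ℝ (Fin n)} (hg : Measurable g)
    (hg₀ : Measurable g₀) (hi : MemLp (fun z => (g₀ - g) (yPart z)) 2 f.law)
    (h : ∫ z, ‖(g₀ - g) (yPart z)‖ ^ 2 ∂f.law = 0) : g =ᵐ[volume] g₀ := by
  rw [integral_eq_zero_iff_of_nonneg (fun z => sq_nonneg _)
    ((memLp_two_iff_integrable_sq_norm hi.1).1 hi)] at h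
  refine (absolutelyContinuous_map_yPart f).ae_le ?_
  refine (ae_map_iff measurable_yPart.aemeasurable (measurableSet_eq_fun hg hg₀)).2 ?_
  filter_upwards [h] with z hz
  have : (g₀ - g) (yPart z) = 0 := by simpa using hz
  exact (sub_eq_zero.1 this).symm

lemma mse_congr_ae (f : GaussianDensity (Fin n ⊕ Fin p))
    {g g' : EuclideanSpace ℝ (Fin p) → EuclideanSpace ℝ (Fin n)} (h : g =ᵐ[volume] g') :
    mse f g = mse f g' := by
  refine integral_congr_ae ?_
  filter_upwards [ae_of_ae_map measurable_yPart.aemeasurable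
    ((map_yPart_absolutelyContinuous f).ae_le h)] with z hz
  rw [hz]

end WorstCase

end RobustStatic

end

/-! ### The saddle point and its uniqueness -/

open RobustStatic in
theorem corollary1 (n p : ℕ) (τ θ : ℝ) (hτ0 : 0 ≤ τ) (hτ1 : τ ≤ 1) (hθ : 0 < θ)
    (m : EuclideanSpace ℝ (Fin n ⊕ Fin p))
    (Kx : Matrix (Fin n) (Fin n) ℝ) (Kxy : Matrix (Fin n) (Fin p) ℝ)
    (Kyx : Matrix (Fin p) (Fin n) ℝ) (Ky : Matrix (Fin p) (Fin p) ℝ)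
    (hK : (Matrix.fromBlocks Kx Kxy Kyx Ky).PosDef)
    (Lz : Matrix (Fin n ⊕ Fin p) (Fin n ⊕ Fin p) ℝ)
    (hLz : Lz * Lz.transpose = Matrix.fromBlocks Kx Kxy Kyx Ky)
    (LP : Matrix (Fin n) (Fin n) ℝ)
    (hLP : LP * LP.transpose = posteriorCov Kx Kxy Kyx Ky)
    (hP : (1 - τ) * specNorm (posteriorCov Kx Kxy Kyx Ky) < θ⁻¹) :
    let f : GaussianDensity (Fin n ⊕ Fin p) := ⟨m, Matrix.fromBlocks Kx Kxy Kyx Ky, hK⟩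
    let B := uncertaintySet τ Lz f
    let G := estimators B
    let J := penalized τ θ Lz f
    let g₀ := bayes m Kxy Ky
    ∃ (Kx' : Matrix (Fin n) (Fin n) ℝ) (hK' : (Matrix.fromBlocks Kx' Kxy Kyx Ky).PosDef),
      let f₀ : GaussianDensity (Fin n ⊕ Fin p) := ⟨m, Matrix.fromBlocks Kx' Kxy Kyx Ky, hK'⟩
      posteriorCov Kx' Kxy Kyx Ky = perturbedCov τ θ LP ∧
      IsMinimaxSolution J G B g₀ f₀ ∧
      (∀ g ∈ G, J f₀ g₀ ≤ J f₀ g) ∧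
      (∀ g f', IsMinimaxSolution J G B g f' → f' = f₀ ∧ g =ᵐ[MeasureTheory.volume] g₀) := by
  intro f B G J g₀
  have hKy : IsUnit Ky.det := (posDef_toBlocks₂₂ f).det_pos.ne'.isUnit
  have hE := errorMatrix_mul_fromBlocks (Kxy := Kxy) hKy
  have hP' : (1 - τ) * specNorm (errorMatrix Kxy Ky * f.cov * (errorMatrix Kxy Ky)ᵀ) < θ⁻¹ := by
    rwa [hE, fromCols_mul_errorMatrix_transpose]
  obtain ⟨Kx', hc, hpost⟩ := exists_worst_cov (τ := τ) (θ := θ) hKy hLz hLP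
  have hK' : (fromBlocks Kx' Kxy Kyx Ky).PosDef := by
    rw [← hc]
    have hPN : (1 - τ) * specNorm ((errorMatrix Kxy Ky * Lz) * (errorMatrix Kxy Ky * Lz)ᵀ)
        < θ⁻¹ := by
      rw [transpose_mul, Matrix.mul_assoc, ← Matrix.mul_assoc Lz, hLz, ← Matrix.mul_assoc]
      exact hP'
    have hB : (θ • ((errorMatrix Kxy Ky * Lz)ᵀ * (errorMatrix Kxy Ky * Lz))).IsHermitian := by
      rw [IsHermitian, conjTranspose_smul, (isHermitian_transpose_mul_self _).eq, star_trivial]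
    exact posDef_conj (isUnit_of_mul_transpose hK hLz) (posDef_cfc hB fun b hb =>
      tiltFun_pos (spectrum_smul_transpose_mul_self hτ1 hθ _ hPN b hb))
  refine ⟨Kx', hK', ?_⟩
  intro f₀
  have hf₀ : f₀ ∈ B := (mem_uncertaintySet_iff hLz).2 fun _ => rfl
  have hg₀ : g₀ ∈ G := bayes_mem_estimators B m Kxy Ky
  have hcols : (errorMatrix Kxy Ky * f₀.cov).toCols₂ = 0 := by
    rw [hE, toCols₂_fromCols]
  have hJ {f' : GaussianDensity (Fin n ⊕ Fin p)} (hf' : f' ∈ B)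
      (g : EuclideanSpace ℝ (Fin p) → EuclideanSpace ℝ (Fin n)) :
      J f' g = ((mse f' g - θ⁻¹ * realDiv τ Lz f' f : ℝ) : EReal) := penalized_eq hLz hf' g
  have hmax {f' : GaussianDensity (Fin n ⊕ Fin p)} (hf' : f' ∈ B) :=
    mse_sub_realDiv_le hτ0 hτ1 hθ (f := f) (f₀ := f₀) hLz hP' rfl hc.symm hf'
  have hbayes {g : EuclideanSpace ℝ (Fin p) → EuclideanSpace ℝ (Fin n)} (hg : g ∈ G) :
      mse f₀ g = mse f₀ g₀ + ∫ z, ‖(g₀ - g) (yPart z)‖ ^ 2 ∂f₀.law :=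
    mse_eq_add hcols hg.1 (hg.2 f₀ hf₀)
  have hworst : ∀ f' ∈ B, J f' g₀ ≤ J f₀ g₀ := fun f' hf' => by
    rw [hJ hf', hJ hf₀, EReal.coe_le_coe_iff]
    exact (hmax hf').1
  have hbest : ∀ g ∈ G, J f₀ g₀ ≤ J f₀ g := fun g hg => by
    rw [hJ hf₀, hJ hf₀, EReal.coe_le_coe_iff, hbayes hg]
    have : 0 ≤ ∫ z, ‖(g₀ - g) (yPart z)‖ ^ 2 ∂f₀.law := integral_nonneg fun z => sq_nonneg _
    linarith
  have hsup : (⨆ f' ∈ B, J f' g₀) ≤ J f₀ g₀ := iSup₂_le hworst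
  refine ⟨hpost, ⟨hg₀, hf₀, fun g hg => ?_, hworst⟩, hbest, fun g f' h => ?_⟩
  -- The saddle inequalities: $\sup_{f'}J(f',g_0)\le J(f_0,g_0)\le J(f_0,g)\le\sup_{f'}J(f',g)$.
  · exact hsup.trans ((hbest g hg).trans (le_iSup₂ (f := fun f' _ => J f' g) f₀ hf₀))
  -- A second minimax `g` has worst case at most $J(f_0,g_0)$, so the orthogonal excess
  -- $\int\|g_0-g\|^2$ under `f₀` must vanish.
  · have hle : J f₀ g ≤ J f₀ g₀ :=
      (le_iSup₂ (f := fun f' _ => J f' g) f₀ hf₀).trans ((h.minimizes g₀ hg₀).trans hsup)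
    rw [hJ hf₀, hJ hf₀, EReal.coe_le_coe_iff, hbayes h.mem_G] at hle
    have hnn : 0 ≤ ∫ z, ‖(g₀ - g) (yPart z)‖ ^ 2 ∂f₀.law := integral_nonneg fun z => sq_nonneg _
    have hae : g =ᵐ[volume] g₀ := ae_eq_of_integral_eq_zero h.mem_G.1 hg₀.1
      (memLp_bayes_sub h.mem_G.1 (h.mem_G.2 f₀ hf₀) _ _ _) (by linarith)
    refine ⟨?_, hae⟩
    -- As `g` and `g₀` have equal errors under every density, `f'` attains the maximum for `g₀` too,
    -- and the equality case identifies it.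
    have hge := h.maximizes f₀ hf₀
    rw [hJ hf₀, hJ h.mem_B, EReal.coe_le_coe_iff, mse_congr_ae f₀ hae, mse_congr_ae f' hae] at hge
    exact (hmax h.mem_B).2 (le_antisymm (hmax h.mem_B).1 hge)
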